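/- For $n\ge 1$ and $p=p(n)\in[0,1]$, choose $n$ points independently and uniformly at random from the unit square and, independently of the points, join each pair of them independently with probability $p$. Give every edge $uv$ of the resulting graph $G$ the weight $d(u,v)$, the Euclidean distance of its ends, and let $d_G(u,v)$ be the weighted shortest-path distance in $G$. If $G$ is connected, its stretch factor is $\mathcal F(n,p)=\max_{u\ne v} d_G(u,v)/d(u,v)$; if $G$ is disconnected, its stretch factor is undefined. A property holds asymptotically almost surely (a.a.s.) if its probability tends to $1$ as $n\to\infty$. Theorem. Suppose that $p=\Omega(1)$ and $n(1-p)=\Omega(1)$, that is, there are constants $\varepsilon,\delta>0$ with $p(n)\ge\varepsilon$ and $n(1-p(n))\ge\delta$ for all sufficiently large $n$. Then there is no constant $C$ for which a.a.s. $$\mathcal F(n,p)\le \frac{C\sqrt{n(1-p)}}{p}+1 ,$$ even if the inequality is regarded as satisfied whenever $G$ is disconnected. In other words, for every constant $C$ the probability that $G$ is connected and $\mathcal F(n,p)>C\sqrt{n(1-p)}/p+1$ does not tend to $0$. -/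

import Mathlib

open MeasureTheory Filter Topology
open scoped ENNReal unitInterval

namespace RandomEmbedding

/-- The Euclidean plane. -/
abbrev Plane : Type := EuclideanSpace ℝ (Fin 2)

/-- The total Euclidean length of a walk in a graph whose vertices are placed in the plane by `x`:
each traversed edge `ab` has weight `d(a, b)`. -/
noncomputable def walkLength {V : Type*} (x : V → Plane) {G : SimpleGraph V} {u v : V}
    (w : G.Walk u v) : ℝ≥0∞ :=
  (w.darts.map fun e => edist (x e.fst) (x e.snd)).sum

/-- The weighted shortest-path distance `d_G(u, v)` of the embedded graph
(it is `∞` if there is no walk from `u` to `v`). -/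
noncomputable def graphDist {V : Type*} (x : V → Plane) (G : SimpleGraph V) (u v : V) : ℝ≥0∞ :=
  ⨅ w : G.Walk u v, walkLength x w

/-- The stretch factor `max d_G(u, v) / d(u, v)` over all pairs of distinct vertices. It is used
only for connected graphs. -/
noncomputable def stretchFactor {V : Type*} (x : V → Plane) (G : SimpleGraph V) : ℝ≥0∞ :=
  ⨆ (u : V) (v : V) (_ : u ≠ v), graphDist x G u v / edist (x u) (x v)

/-- The closed unit square `[0, 1]²` in the plane. -/
def unitSquare : Set Plane := {z | ∀ i, z i ∈ Set.Icc (0 : ℝ) 1}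

/-- The uniform distribution on the unit square. -/
noncomputable def uniformSquare : Measure Plane := volume.restrict unitSquare

theorem volume_unitSquare : volume unitSquare = 1 := by
  have h := (PiLp.volume_preserving_ofLp (ι := Fin 2)).measure_preimage
    (s := Set.univ.pi fun _ => Set.Icc (0 : ℝ) 1)
    (MeasurableSet.univ_pi fun _ => measurableSet_Icc).nullMeasurableSet
  have e : unitSquare = (WithLp.ofLp ⁻¹' (Set.univ.pi fun _ : Fin 2 => Set.Icc (0 : ℝ) 1)
      : Set Plane) := by
    ext z
    simp only [unitSquare, Set.mem_preimage, Set.mem_pi, Set.mem_univ, true_imp_iff]; rfl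
  rw [e, h, volume_pi, Measure.pi_pi]
  simp

instance isProbabilityMeasure_uniformSquare : IsProbabilityMeasure uniformSquare :=
  ⟨by rw [uniformSquare, Measure.restrict_apply_univ, volume_unitSquare]⟩

/-- The law of a randomly embedded random graph on the vertex set `Fin n`: the positions of the
vertices are independent and uniform in the unit square, and, independently of the positions, each
pair of distinct vertices is joined independently with probability `p`. -/
noncomputable def embeddedGraphLaw (n : ℕ) (p : I) :
    Measure ((Fin n → Plane) × SimpleGraph (Fin n)) :=
  (Measure.pi fun _ => uniformSquare).prod (SimpleGraph.binomialRandom (Fin n) p)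

instance isProbabilityMeasure_embeddedGraphLaw (n : ℕ) (p : I) :
    IsProbabilityMeasure (embeddedGraphLaw n p) := by
  unfold embeddedGraphLaw
  infer_instance

/-- A property of the randomly embedded random graph with parameters `n` and `p n` holds
asymptotically almost surely if its probability tends to `1` as `n → ∞`. -/
def HoldsAas (p : ℕ → I) (E : ∀ n : ℕ, (Fin n → Plane) → SimpleGraph (Fin n) → Prop) : Prop :=
  Tendsto (fun n => embeddedGraphLaw n (p n) {ω | E n ω.1 ω.2}) atTop (𝓝 1)

end RandomEmbedding

namespace RandomEmbedding


/-! Write `q = 1 - p`. The obstruction is a non-adjacent pair `i, j` at distance less than `r`, with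
every other point at distance at least `s` from `i`. Any walk from `i` to `j` starts with an edge of
length at least `s`, so the stretch factor is at least `s / r` (`le_stretchFactor_of_isolatedPair`).

Take `s = 1 / (3√n)`, so that isolation costs only a constant factor, and `r = c / (√n √(nq))`. Then
`s / r = √(nq) / (3c)`, which beats the proposed bound once `c` is small, while the expected number
of such pairs is of constant order `n² q r² = c²`. Two of these events are disjoint if they share a
point (as `2r ≤ s`) and are otherwise controlled by independence. Bonferroni's inequality therefore
gives one of them with probability at least a constant `κ > 0`
(`le_embeddedGraphLaw_biUnion_stretchedPair`).

Since `p` is bounded below, disconnection has probability tending to `0`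
(`tendsto_binomialRandom_not_connected`) and cannot absorb this failure. -/

/-! ### Missing edges and connectivity of the binomial random graph. -/

theorem binomialRandom_real_forall_notMem {V : Type*} [Countable V] (p : I) (F : Finset (Sym2 V))
    (hF : ∀ e ∈ F, ¬ e.IsDiag) :
    (SimpleGraph.binomialRandom V p).real {G | ∀ e ∈ F, e ∉ G.edgeSet} = (1 - p : ℝ) ^ F.card := by
  have hm : MeasurableSet {G : SimpleGraph V | ∀ e ∈ F, e ∉ G.edgeSet} := by
    have : {G : SimpleGraph V | ∀ e ∈ F, e ∉ G.edgeSet} =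
        ⋂ e ∈ F, SimpleGraph.edgeSet ⁻¹' {s | e ∈ s}ᶜ := by
      ext G; simp
    rw [this]
    refine Finset.measurableSet_biInter _ fun e _ => SimpleGraph.measurable_edgeSet ?_
    exact (measurableSet_setOfPred.2 (measurable_set_mem e)).compl
  rw [SimpleGraph.binomialRandom_eq_map, measureReal_def,
    Measure.map_apply SimpleGraph.measurable_fromEdgeSet hm,
    ProbabilityTheory.setBernoulli_apply']
  -- In terms of edge indicators the event is a cylinder over `F`, so its product measure factors;
  -- no diagonal pair lies in `F`, so each factor is `1 - p`.
  have : ((fun p : Sym2 V → Prop ↦ {i | p i}) ⁻¹' (SimpleGraph.fromEdgeSet ⁻¹'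
      {G : SimpleGraph V | ∀ e ∈ F, e ∉ G.edgeSet})) = Set.pi F fun _ => {False} := by
    ext f
    simp only [Set.mem_preimage, Set.mem_ofPred_eq, SimpleGraph.edgeSet_fromEdgeSet, Set.mem_sdiff,
      Set.mem_pi, Finset.mem_coe, Set.mem_singleton_iff, eq_iff_iff, iff_false]
    refine forall₂_congr fun e he => ?_
    have := hF e he
    simp_all
  rw [this, Measure.infinitePi_pi]
  · rw [Finset.prod_congr rfl (g := fun _ => ENNReal.ofReal (1 - p))]
    · rw [Finset.prod_const, ENNReal.toReal_pow, ENNReal.toReal_ofReal]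
      linarith [p.2.2]
    · intro e he
      have h := hF e he
      rw [ENNReal.ofReal, Real.toNNReal_of_nonneg (by linarith [p.2.2])]
      simp [h]
      rfl
  · simp

theorem exists_cut_of_not_connected {V : Type*} [Fintype V] [Nonempty V]
    [DecidableEq V] {G : SimpleGraph V} (hG : ¬ G.Connected) :
    ∃ S : Finset V, S.Nonempty ∧ 2 * S.card ≤ Fintype.card V ∧
      ∀ u ∈ S, ∀ v ∉ S, ¬ G.Adj u v := by
  classical
  have hpre : ¬ G.Preconnected := fun h => hG ⟨h⟩
  simp only [SimpleGraph.Preconnected, not_forall] at hpre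
  obtain ⟨a, b, hab⟩ := hpre
  let T : Finset V := Finset.univ.filter fun v => G.Reachable a v
  have hT : ∀ u ∈ T, ∀ v ∉ T, ¬ G.Adj u v := by
    intro u hu v hv h
    simp only [T, Finset.mem_filter, Finset.mem_univ, true_and] at hu hv
    exact hv (hu.trans h.reachable)
  by_cases hc : 2 * T.card ≤ Fintype.card V
  · exact ⟨T, ⟨a, by simp [T]⟩, hc, hT⟩
  · refine ⟨Tᶜ, ⟨b, by simpa [T] using hab⟩, ?_, ?_⟩
    · have := Finset.card_add_card_compl T
      omega
    · intro u hu v hv h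
      simp only [Finset.mem_compl, not_not] at hu hv
      exact hT v hv u hu h.symm

theorem binomialRandom_real_cut {V : Type*} [Fintype V] [DecidableEq V] (p : I) (S : Finset V) :
    (SimpleGraph.binomialRandom V p).real {G | ∀ u ∈ S, ∀ v ∉ S, ¬ G.Adj u v} =
      (1 - p : ℝ) ^ (S.card * Sᶜ.card) := by
  have h := binomialRandom_real_forall_notMem p ((S ×ˢ Sᶜ).image fun z => s(z.1, z.2)) (by
    simp only [Finset.mem_image, Finset.mem_product, Finset.mem_compl, Prod.exists]
    rintro _ ⟨a, b, ⟨ha, hb⟩, rfl⟩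
    simp only [Sym2.mk_isDiag_iff]
    rintro rfl
    exact hb ha)
  rw [Finset.card_image_of_injOn, Finset.card_product] at h
  · rw [← h]
    congr 1
    ext G
    constructor
    · intro h e he
      obtain ⟨⟨a, b⟩, hab, rfl⟩ := Finset.mem_image.1 he
      simp only [Finset.mem_product, Finset.mem_compl] at hab
      exact h a hab.1 b hab.2
    · intro h u hu v hv
      exact h s(u, v) (Finset.mem_image.2 ⟨(u, v), by simp [hu, hv], rfl⟩)
  · rintro ⟨a, b⟩ hab ⟨c, d⟩ hcd h
    simp at hab hcd h
    grind

/-- Union bound over the smaller sides `S` of empty cuts: the other side has at least `n / 2`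
vertices, so each cut contributes at most `x ^ |S|`, and the binomial theorem sums these over all
nonempty `S`. -/
theorem binomialRandom_real_not_connected_le {n : ℕ} (hn : 0 < n) (p : I) :
    (SimpleGraph.binomialRandom (Fin n) p).real {G | ¬ G.Connected} ≤
      (1 + (1 - p : ℝ) ^ (n / 2)) ^ n - 1 := by
  have : Nonempty (Fin n) := ⟨⟨0, hn⟩⟩
  have hq0 : 0 ≤ (1 - p : ℝ) := by linarith [p.2.2]
  have hq1 : (1 - p : ℝ) ≤ 1 := by linarith [p.2.1]
  set x : ℝ := (1 - p : ℝ) ^ (n / 2)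
  have hx : 0 ≤ x := by positivity
  let 𝒮 : Finset (Finset (Fin n)) := Finset.univ.filter fun S => S.Nonempty ∧ 2 * S.card ≤ n
  calc (SimpleGraph.binomialRandom (Fin n) p).real {G | ¬ G.Connected}
      ≤ (SimpleGraph.binomialRandom (Fin n) p).real
          (⋃ S ∈ 𝒮, {G | ∀ u ∈ S, ∀ v ∉ S, ¬ G.Adj u v}) := by
        refine measureReal_mono (fun G hG => ?_) (measure_ne_top _ _)
        obtain ⟨S, h1, h2, h3⟩ := exists_cut_of_not_connected hG
        simp only [Set.mem_iUnion]
        exact ⟨S, by simpa [𝒮, h1] using h2, h3⟩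
    _ ≤ ∑ S ∈ 𝒮, (SimpleGraph.binomialRandom (Fin n) p).real
          {G | ∀ u ∈ S, ∀ v ∉ S, ¬ G.Adj u v} := measureReal_biUnion_finset_le _ _
    _ ≤ ∑ S ∈ 𝒮, x ^ S.card := by
        refine Finset.sum_le_sum fun S hS => ?_
        rw [binomialRandom_real_cut, mul_comm, pow_mul]
        refine pow_le_pow_left₀ (by positivity) (pow_le_pow_of_le_one hq0 hq1 ?_) _
        have := Finset.card_add_card_compl S
        simp only [𝒮, Finset.mem_filter, Fintype.card_fin] at hS this
        omega
    _ ≤ ∑ S ∈ (Finset.univ : Finset (Finset (Fin n))).erase ∅, x ^ S.card := by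
        refine Finset.sum_le_sum_of_subset_of_nonneg (fun S hS => ?_) fun _ _ _ => by positivity
        simp [𝒮] at hS
        simpa using hS.1.ne_empty
    _ = (1 + x) ^ n - 1 := by
        have h := Fintype.sum_pow_mul_eq_add_pow (Fin n) x 1
        rw [← Finset.add_sum_erase _ _ (Finset.mem_univ ∅)] at h
        simp only [one_pow, mul_one, Finset.card_empty, pow_zero, Fintype.card_fin] at h
        rw [add_comm 1 x, ← h]
        ring

theorem tendsto_binomialRandom_not_connected (p : ℕ → I)
    (hp : ∃ ε : ℝ, 0 < ε ∧ ∀ᶠ n : ℕ in atTop, ε ≤ (p n : ℝ)) :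
    Tendsto (fun n => (SimpleGraph.binomialRandom (Fin n) (p n)).real {G | ¬ G.Connected})
      atTop (𝓝 0) := by
  obtain ⟨ε, hε, h⟩ := hp
  obtain ⟨n₀, hn₀⟩ := h.exists
  have hε1 : ε ≤ 1 := hn₀.trans (p n₀).2.2
  have hlim : Tendsto (fun n : ℕ => (n : ℝ) * (1 - ε) ^ (n / 2)) atTop (𝓝 0) := by
    -- To be used with `m = n / 2`, where `n ≤ 2m + 1` despite the rounding.
    have h1 : Tendsto (fun m : ℕ => (2 * (m : ℝ) + 1) * (1 - ε) ^ m) atTop (𝓝 0) := by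
      have h2 := tendsto_self_mul_const_pow_of_lt_one (r := 1 - ε) (by linarith) (by linarith)
      have h3 := tendsto_pow_atTop_nhds_zero_of_lt_one (r := 1 - ε) (by linarith) (by linarith)
      have := (h2.const_mul 2).add h3
      simp only [mul_zero, add_zero] at this
      refine this.congr fun m => by ring
    have h4 := h1.comp (Nat.tendsto_div_const_atTop two_ne_zero)
    refine squeeze_zero (fun n => mul_nonneg (by positivity) (pow_nonneg (by linarith) _)) (fun n => ?_) h4
    simp only [Function.comp]
    refine mul_le_mul_of_nonneg_right ?_ (pow_nonneg (by linarith) _)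
    · have : n ≤ 2 * (n / 2) + 1 := by omega
      exact_mod_cast this
  have hub : Tendsto (fun n : ℕ => Real.exp ((n : ℝ) * (1 - ε) ^ (n / 2)) - 1) atTop (𝓝 0) := by
    have := (Real.continuous_exp.tendsto 0).comp hlim
    simpa using this.sub_const 1
  refine squeeze_zero' (.of_forall fun _ => measureReal_nonneg) ?_ hub
  filter_upwards [h, eventually_gt_atTop 0] with n hn hn0
  refine (binomialRandom_real_not_connected_le hn0 _).trans ?_
  have hq0 : 0 ≤ (1 - p n : ℝ) := by linarith [(p n).2.2]
  gcongr
  calc (1 + (1 - p n : ℝ) ^ (n / 2)) ^ n ≤ (Real.exp ((1 - ε) ^ (n / 2))) ^ n := by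
        gcongr
        rw [add_comm]
        refine le_trans (Real.add_one_le_exp _) ?_
        gcongr
    _ = _ := by rw [← Real.exp_nat_mul]


/-! ### Close and isolated pairs of uniform points. -/

theorem measurableSet_unitSquare : MeasurableSet unitSquare := by
  have : unitSquare = ⋂ i : Fin 2, (fun z : Plane => z i) ⁻¹' Set.Icc (0 : ℝ) 1 := by
    ext z; simp [unitSquare]
  rw [this]
  exact MeasurableSet.iInter fun i => measurableSet_Icc.preimage (by fun_prop)

theorem uniformSquare_ball_le (x : Plane) (r : ℝ) :
    uniformSquare (Metric.ball x r) ≤ ENNReal.ofReal r ^ 2 * ENNReal.ofReal Real.pi := by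
  rw [← EuclideanSpace.volume_ball_fin_two x r]
  exact Measure.restrict_apply_le _ _

/-- The centre of the unit square. -/
noncomputable def squareCenter : Plane := WithLp.toLp 2 fun _ => 1 / 2

theorem ball_squareCenter_subset : Metric.ball squareCenter (1 / 2) ⊆ unitSquare := by
  intro z hz i
  rw [Metric.mem_ball, EuclideanSpace.dist_eq] at hz
  have h1 : dist (z i) (squareCenter i) ≤ √(∑ j, dist (z j) (squareCenter j) ^ 2) := by
    refine Real.le_sqrt_of_sq_le ?_
    exact Finset.single_le_sum (f := fun j => dist (z j) (squareCenter j) ^ 2)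
      (fun _ _ => by positivity) (Finset.mem_univ i)
  have h2 := h1.trans_lt hz
  simp only [squareCenter, Real.dist_eq, abs_lt] at h2
  constructor <;> linarith [h2.1, h2.2]

theorem uniformSquare_ball_of_subset {x : Plane} {r : ℝ} (h : Metric.ball x r ⊆ unitSquare) :
    uniformSquare (Metric.ball x r) = ENNReal.ofReal r ^ 2 * ENNReal.ofReal Real.pi := by
  rw [uniformSquare, Measure.restrict_apply' measurableSet_unitSquare,
    Set.inter_eq_self_of_subset_left h, EuclideanSpace.volume_ball_fin_two]

/-- Fubini for an event that constrains all the coordinates but one in terms of that one. -/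
theorem pi_setOf_forall_succAbove {α : Type*} [MeasurableSpace α] (ν : Measure α)
    [IsProbabilityMeasure ν] {m : ℕ} (i : Fin (m + 1)) (S : Fin m → α → Set α)
    (hS : MeasurableSet {x : Fin (m + 1) → α | ∀ k, x (i.succAbove k) ∈ S k (x i)}) :
    Measure.pi (fun _ => ν) {x : Fin (m + 1) → α | ∀ k, x (i.succAbove k) ∈ S k (x i)} =
      ∫⁻ a, ∏ k, ν (S k a) ∂ν := by
  have e := (measurePreserving_piFinSuccAbove (fun _ : Fin (m + 1) => ν) i).symm
  rw [← e.measure_preimage hS.nullMeasurableSet, Measure.prod_apply (e.measurable hS)]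
  refine lintegral_congr fun a => ?_
  rw [← Measure.pi_pi]
  congr 1
  ext y
  change (∀ k, i.insertNth (α := fun _ => α) a y (i.succAbove k) ∈
    S k (i.insertNth (α := fun _ => α) a y i)) ↔ _
  simp

theorem measurable_dist_eval {n : ℕ} (i j : Fin n) :
    Measurable fun x : Fin n → Plane => dist (x j) (x i) := by
  fun_prop

/-- The event that the points `i` and `j` are at distance less than `r`. -/
def closePair {n : ℕ} (r : ℝ) (i j : Fin n) : Set (Fin n → Plane) :=
  {x | dist (x j) (x i) < r}

theorem measurableSet_closePair {n : ℕ} (r : ℝ) (i j : Fin n) :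
    MeasurableSet (closePair r i j) :=
  measurableSet_lt (measurable_dist_eval i j) measurable_const

/-- The event that the points `i` and `j` are at distance less than `r`, while all other points are
at distance at least `s` from `i`. -/
def isolatedPair {n : ℕ} (r s : ℝ) (i j : Fin n) : Set (Fin n → Plane) :=
  {x | dist (x j) (x i) < r ∧ ∀ k, k ≠ i → k ≠ j → s ≤ dist (x k) (x i)}

theorem isolatedPair_subset {n : ℕ} (r s : ℝ) (i j : Fin n) :
    isolatedPair r s i j ⊆ closePair r i j :=
  fun _ hx => hx.1

theorem measurableSet_isolatedPair {n : ℕ} (r s : ℝ) (i j : Fin n) :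
    MeasurableSet (isolatedPair r s i j) := by
  have : isolatedPair r s i j = closePair r i j ∩
      ⋂ k, ⋂ (_ : k ≠ i), ⋂ (_ : k ≠ j), {x | s ≤ dist (x k) (x i)} := by
    ext x; simp [isolatedPair, closePair]
  rw [this]
  exact (measurableSet_closePair r i j).inter <| .iInter fun k => .iInter fun _ => .iInter fun _ =>
    measurableSet_le measurable_const (measurable_dist_eval i k)

theorem pi_closePair_le {n : ℕ} (r : ℝ) {i j : Fin n} (hij : i ≠ j) :
    Measure.pi (fun _ => uniformSquare) (closePair r i j) ≤
      ENNReal.ofReal r ^ 2 * ENNReal.ofReal Real.pi := by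
  obtain _ | m := n
  · exact i.elim0
  obtain ⟨k₀, rfl⟩ := Fin.exists_succAbove_eq hij.symm
  have e : closePair r i (i.succAbove k₀) = {x : Fin (m + 1) → Plane | ∀ k, x (i.succAbove k) ∈
      (fun (k : Fin m) a => if k = k₀ then Metric.ball a r else Set.univ) k (x i)} := by
    ext x
    simp only [closePair, Set.mem_ofPred_eq]
    constructor
    · intro h k
      split_ifs with hk
      · subst hk; exact h
      · trivial
    · intro h
      simpa using h k₀
  have hm := measurableSet_closePair r i (i.succAbove k₀)
  rw [e] at hm ⊢
  rw [pi_setOf_forall_succAbove uniformSquare i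
    (fun k a => if k = k₀ then Metric.ball a r else Set.univ) hm]
  calc _ ≤ ∫⁻ _, ENNReal.ofReal r ^ 2 * ENNReal.ofReal Real.pi ∂uniformSquare := by
        refine lintegral_mono fun a => ?_
        rw [← Finset.mul_prod_erase _ _ (Finset.mem_univ k₀), Finset.prod_eq_one]
        · simpa using uniformSquare_ball_le a r
        · intro k hk
          simp [(Finset.mem_erase.1 hk).1]
    _ = _ := by simp

/-- Restrict `x i` to the disc of radius `1/4` about the centre: the `r`-disc around it then lies in
the square and has its full area. Given `x i`, the other points are independent, and each of the
remaining `n - 2` avoids the `s`-disc with probability at least `1 - π s²`. -/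
theorem le_pi_isolatedPair {n : ℕ} {r s : ℝ} (hr : r ≤ 1 / 4) {i j : Fin n} (hij : i ≠ j) :
    (ENNReal.ofReal (1 / 4) ^ 2 * ENNReal.ofReal Real.pi) *
      ((ENNReal.ofReal r ^ 2 * ENNReal.ofReal Real.pi) *
        (1 - ENNReal.ofReal s ^ 2 * ENNReal.ofReal Real.pi) ^ (n - 2)) ≤
      Measure.pi (fun _ => uniformSquare) (isolatedPair r s i j) := by
  obtain _ | m := n
  · exact i.elim0
  obtain ⟨k₀, rfl⟩ := Fin.exists_succAbove_eq hij.symm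
  have e : isolatedPair r s i (i.succAbove k₀) =
      {x : Fin (m + 1) → Plane | ∀ k, x (i.succAbove k) ∈
      (fun (k : Fin m) a => if k = k₀ then Metric.ball a r else (Metric.ball a s)ᶜ) k (x i)} := by
    ext x
    simp only [isolatedPair, Set.mem_ofPred_eq]
    constructor
    · intro h k
      split_ifs with hk
      · subst hk; exact h.1
      · simpa using h.2 (i.succAbove k) (Fin.succAbove_ne i k) (by simpa using hk)
    · intro h
      refine ⟨by simpa using h k₀, fun l hl hl' => ?_⟩
      obtain ⟨k, rfl⟩ := Fin.exists_succAbove_eq hl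
      have hk : k ≠ k₀ := fun hk => hl' (by rw [hk])
      simpa [hk] using h k
  have hm := measurableSet_isolatedPair r s i (i.succAbove k₀)
  rw [e] at hm ⊢
  rw [pi_setOf_forall_succAbove uniformSquare i
    (fun k a => if k = k₀ then Metric.ball a r else (Metric.ball a s)ᶜ) hm]
  have hc : uniformSquare (Metric.ball squareCenter (1 / 4)) =
      ENNReal.ofReal (1 / 4) ^ 2 * ENNReal.ofReal Real.pi :=
    uniformSquare_ball_of_subset
      ((Metric.ball_subset_ball (by norm_num)).trans ball_squareCenter_subset)
  rw [mul_comm, ← hc, ← setLIntegral_const]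
  refine le_trans (setLIntegral_mono' Metric.isOpen_ball.measurableSet fun a ha => ?_)
    (setLIntegral_le_lintegral (Metric.ball squareCenter (1 / 4)) _)
  rw [← Finset.mul_prod_erase _ _ (Finset.mem_univ k₀)]
  refine mul_le_mul' ?_ ?_
  · rw [if_pos rfl, uniformSquare_ball_of_subset]
    refine (Metric.ball_subset_ball' ?_).trans ball_squareCenter_subset
    rw [Metric.mem_ball] at ha
    linarith
  · have hcard : m + 1 - 2 = ((Finset.univ : Finset (Fin m)).erase k₀).card := by
      rw [Finset.card_erase_of_mem (Finset.mem_univ _), Finset.card_univ, Fintype.card_fin]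
      omega
    rw [hcard]
    refine Finset.pow_card_le_prod _ _ _ fun k hk => ?_
    rw [if_neg (Finset.mem_erase.1 hk).1, prob_compl_eq_one_sub Metric.isOpen_ball.measurableSet]
    exact tsub_le_tsub_left (uniformSquare_ball_le a s) 1

theorem pi_closePair_inter_le {n : ℕ} (r : ℝ) {i j k l : Fin n} (hij : i ≠ j) (hkl : k ≠ l)
    (hik : i ≠ k) (hil : i ≠ l) (hjk : j ≠ k) (hjl : j ≠ l) :
    Measure.pi (fun _ => uniformSquare) (closePair r i j ∩ closePair r k l) ≤
      (ENNReal.ofReal r ^ 2 * ENNReal.ofReal Real.pi) ^ 2 := by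
  have hind : ProbabilityTheory.iIndepFun (fun (i : Fin n) (x : Fin n → Plane) => x i)
      (Measure.pi fun _ => uniformSquare) :=
    ProbabilityTheory.iIndepFun_pi (X := fun _ z => z) fun _ => aemeasurable_id
  have h := (hind.indepFun_prodMk_prodMk (fun i => measurable_pi_apply i)
    i j k l hik hil hjk hjl).measure_inter_preimage_eq_mul
      {z | dist z.2 z.1 < r} {z | dist z.2 z.1 < r}
      (measurableSet_lt (by fun_prop) measurable_const)
      (measurableSet_lt (by fun_prop) measurable_const)
  change Measure.pi _ (closePair r i j ∩ closePair r k l) =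
    Measure.pi _ (closePair r i j) * Measure.pi _ (closePair r k l) at h
  rw [h, sq]
  exact mul_le_mul' (pi_closePair_le r hij) (pi_closePair_le r hkl)

/-- The far end of one pair would be within `2r ≤ s` of the first point of the other, against
isolation. Ordering the pairs excludes the same pair listed twice. -/
theorem isolatedPair_inter_eq_empty {n : ℕ} {r s : ℝ} (hrs : 2 * r ≤ s) {i j k l : Fin n}
    (hij : i < j) (hkl : k < l) (hne : (i, j) ≠ (k, l))
    (hmeet : i = k ∨ i = l ∨ j = k ∨ j = l) :
    isolatedPair r s i j ∩ isolatedPair r s k l = ∅ := by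
  rw [Set.eq_empty_iff_forall_notMem]
  rintro x ⟨⟨h1, h2⟩, ⟨h3, h4⟩⟩
  have h0 : 0 ≤ dist (x j) (x i) := dist_nonneg
  rcases hmeet with rfl | rfl | rfl | rfl
  · have := h2 l hkl.ne' (by rintro rfl; exact hne rfl)
    linarith
  · have := h2 k hkl.ne (by rintro rfl; exact absurd hkl hij.not_gt)
    rw [dist_comm] at this
    linarith
  · have := h2 l (hij.trans hkl).ne' hkl.ne'
    have := dist_triangle (x l) (x j) (x i)
    linarith
  · have := h2 k (by rintro rfl; exact hne rfl) hkl.ne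
    have := dist_triangle (x k) (x j) (x i)
    rw [dist_comm (x k) (x j)] at this
    linarith


/-! ### From isolated non-adjacent pairs to large stretch. -/

theorem le_graphDist_of_isolatedPair {n : ℕ} {r s : ℝ} {i j : Fin n} (hij : i ≠ j)
    {x : Fin n → Plane} {G : SimpleGraph (Fin n)} (hx : x ∈ isolatedPair r s i j)
    (hG : ¬ G.Adj i j) : ENNReal.ofReal s ≤ graphDist x G i j := by
  refine le_iInf fun w => ?_
  cases w with
  | nil => exact absurd rfl hij
  | @cons _ k _ h w =>
    have hk : k ≠ j := fun hk => hG (hk ▸ h)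
    have hs := hx.2 k h.ne' hk
    rw [walkLength, SimpleGraph.Walk.darts_cons, List.map_cons, List.sum_cons]
    refine le_trans ?_ le_self_add
    rw [edist_comm, edist_dist]
    exact ENNReal.ofReal_le_ofReal hs

theorem le_stretchFactor_of_isolatedPair {n : ℕ} {r s : ℝ} (hr : 0 < r) {i j : Fin n} (hij : i ≠ j)
    {x : Fin n → Plane} {G : SimpleGraph (Fin n)} (hx : x ∈ isolatedPair r s i j)
    (hG : ¬ G.Adj i j) : ENNReal.ofReal (s / r) ≤ stretchFactor x G := by
  refine le_trans ?_ (le_iSup_of_le i <| le_iSup_of_le j <| le_iSup_of_le hij le_rfl)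
  rw [ENNReal.ofReal_div_of_pos hr]
  refine ENNReal.div_le_div (le_graphDist_of_isolatedPair hij hx hG) ?_
  rw [edist_comm, edist_dist]
  exact ENNReal.ofReal_le_ofReal hx.1.le

theorem measurableSet_not_adj {V : Type*} (i j : V) :
    MeasurableSet {G : SimpleGraph V | ¬ G.Adj i j} :=
  measurableSet_setOfPred.2 (by fun_prop)

theorem binomialRandom_real_not_adj {n : ℕ} (p : I) {i j : Fin n} (hij : i ≠ j) :
    (SimpleGraph.binomialRandom (Fin n) p).real {G | ¬ G.Adj i j} = 1 - p := by
  have := binomialRandom_real_forall_notMem p {s(i, j)} (by simpa using hij)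
  simpa using this

theorem binomialRandom_real_not_adj_inter {n : ℕ} (p : I) {i j k l : Fin n} (hij : i ≠ j)
    (hkl : k ≠ l) (hne : s(i, j) ≠ s(k, l)) :
    (SimpleGraph.binomialRandom (Fin n) p).real ({G | ¬ G.Adj i j} ∩ {G | ¬ G.Adj k l}) =
      (1 - p : ℝ) ^ 2 := by
  have := binomialRandom_real_forall_notMem p {s(i, j), s(k, l)} (by
    simp only [Finset.mem_insert, Finset.mem_singleton]
    rintro _ (rfl | rfl) <;> simpa)
  rw [Finset.card_pair hne] at this
  rw [← this]
  congr 1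
  ext G
  simp

theorem pi_real_closePair_inter_le {n : ℕ} {r : ℝ} (hr : 0 ≤ r) {i j k l : Fin n} (hij : i ≠ j)
    (hkl : k ≠ l) (hik : i ≠ k) (hil : i ≠ l) (hjk : j ≠ k) (hjl : j ≠ l) :
    (Measure.pi fun _ => uniformSquare).real (closePair r i j ∩ closePair r k l) ≤
      (r ^ 2 * Real.pi) ^ 2 := by
  refine ENNReal.toReal_le_of_le_ofReal (by positivity) ?_
  refine (pi_closePair_inter_le r hij hkl hik hil hjk hjl).trans_eq ?_
  rw [ENNReal.ofReal_pow (by positivity), ENNReal.ofReal_mul (by positivity), ENNReal.ofReal_pow hr]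

theorem le_pi_real_isolatedPair {n : ℕ} {r s : ℝ} (hr0 : 0 ≤ r) (hr : r ≤ 1 / 4) (hs0 : 0 ≤ s)
    (hs : s ^ 2 * Real.pi ≤ 1) {i j : Fin n} (hij : i ≠ j) :
    ((1 / 4) ^ 2 * Real.pi) * ((r ^ 2 * Real.pi) * (1 - s ^ 2 * Real.pi) ^ (n - 2)) ≤
      (Measure.pi fun _ => uniformSquare).real (isolatedPair r s i j) := by
  have hs' : 0 ≤ 1 - s ^ 2 * Real.pi := by linarith
  rw [measureReal_def, ← ENNReal.ofReal_le_iff_le_toReal (measure_ne_top _ _)]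
  refine le_trans (le_of_eq ?_) (le_pi_isolatedPair (s := s) hr hij)
  rw [ENNReal.ofReal_mul (by positivity), ENNReal.ofReal_mul (by positivity),
    ENNReal.ofReal_mul (by positivity), ENNReal.ofReal_mul (by positivity), ENNReal.ofReal_pow hs',
    ENNReal.ofReal_pow hr0, ENNReal.ofReal_pow (by norm_num), ENNReal.ofReal_sub _ (by positivity),
    ENNReal.ofReal_mul (by positivity), ENNReal.ofReal_pow hs0, ENNReal.ofReal_one]

/-! ### Second-moment bound for the existence of a stretched pair. -/

/-- Bonferroni's lower bound for the probability of a union. -/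
theorem sum_sub_sum_inter_le_measureReal_biUnion {Ω ι : Type*} [MeasurableSpace Ω] [DecidableEq ι]
    (μ : Measure Ω) [IsFiniteMeasure μ] (s : Finset ι) {A : ι → Set Ω}
    (hA : ∀ i, MeasurableSet (A i)) :
    ∑ i ∈ s, (μ.real (A i) - ∑ j ∈ s.erase i, μ.real (A i ∩ A j)) ≤ μ.real (⋃ i ∈ s, A i) := by
  -- Keeping only outcomes where, among the events indexed by `s`, `A i` alone occurs makes the
  -- pieces disjoint.
  let B : ι → Set Ω := fun i => A i \ ⋃ j ∈ s.erase i, A j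
  have hB : ∀ i, MeasurableSet (B i) := fun i =>
    (hA i).diff (Finset.measurableSet_biUnion _ fun j _ => hA j)
  have hdisj : (s : Set ι).PairwiseDisjoint B := by
    intro i hi j hj hij
    rw [Function.onFun, Set.disjoint_left]
    rintro ω ⟨h1, -⟩ ⟨-, h4⟩
    refine h4 (Set.mem_biUnion (x := i) ?_ h1)
    exact Finset.mem_erase.2 ⟨hij, hi⟩
  calc ∑ i ∈ s, (μ.real (A i) - ∑ j ∈ s.erase i, μ.real (A i ∩ A j))
      ≤ ∑ i ∈ s, μ.real (B i) := by
        refine Finset.sum_le_sum fun i _ => ?_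
        have h1 : μ.real (A i) ≤ μ.real (B i ∪ ⋃ j ∈ s.erase i, A i ∩ A j) := by
          refine measureReal_mono (fun ω hω => ?_) (measure_ne_top _ _)
          by_cases h : ω ∈ ⋃ j ∈ s.erase i, A j
          · refine Or.inr ?_
            simp only [Set.mem_iUnion] at h ⊢
            obtain ⟨j, hj, hωj⟩ := h
            exact ⟨j, hj, hω, hωj⟩
          · exact Or.inl ⟨hω, h⟩
        have h2 := measureReal_union_le (μ := μ) (B i) (⋃ j ∈ s.erase i, A i ∩ A j)
        have h3 := measureReal_biUnion_finset_le (μ := μ) (s.erase i) fun j => A i ∩ A j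
        linarith
    _ = μ.real (⋃ i ∈ s, B i) := (measureReal_biUnion_finset hdisj fun i _ => hB i).symm
    _ ≤ μ.real (⋃ i ∈ s, A i) := by
        refine measureReal_mono (fun ω hω => ?_) (measure_ne_top _ _)
        simp only [Set.mem_iUnion] at hω ⊢
        obtain ⟨i, hi, h⟩ := hω
        exact ⟨i, hi, h.1⟩

/-- The increasing pairs of indices below `n`. -/
def increasingPairs (n : ℕ) : Finset (Fin n × Fin n) :=
  Finset.univ.filter fun e => e.1 < e.2

theorem two_mul_card_increasingPairs (n : ℕ) : 2 * (increasingPairs n).card = n * n - n := by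
  have h1 : (Finset.univ : Finset (Fin n)).offDiag =
      increasingPairs n ∪ (increasingPairs n).map (Equiv.prodComm _ _).toEmbedding := by
    ext ⟨a, b⟩
    simp [increasingPairs]
  have h2 : Disjoint (increasingPairs n)
      ((increasingPairs n).map (Equiv.prodComm _ _).toEmbedding) := by
    rw [Finset.disjoint_left]
    rintro ⟨a, b⟩
    simp [increasingPairs]
    omega
  have h3 := congrArg Finset.card h1
  rw [Finset.card_union_of_disjoint h2, Finset.card_map, Finset.offDiag_card, Finset.card_univ,
    Fintype.card_fin] at h3
  omega

/-- The event that the points `i` and `j` are at distance less than `r`, are not joined, and all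
other points are at distance at least `s` from `i`. -/
def stretchedPair {n : ℕ} (r s : ℝ) (e : Fin n × Fin n) :
    Set ((Fin n → Plane) × SimpleGraph (Fin n)) :=
  isolatedPair r s e.1 e.2 ×ˢ {G | ¬ G.Adj e.1 e.2}

theorem measurableSet_stretchedPair {n : ℕ} (r s : ℝ) (e : Fin n × Fin n) :
    MeasurableSet (stretchedPair r s e) :=
  (measurableSet_isolatedPair r s e.1 e.2).prod (measurableSet_not_adj e.1 e.2)

theorem le_embeddedGraphLaw_stretchedPair {n : ℕ} (p : I) {r s : ℝ} (hr0 : 0 ≤ r) (hr : r ≤ 1 / 4)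
    (hs0 : 0 ≤ s) (hs : n * s ^ 2 ≤ 1 / 8) {e : Fin n × Fin n} (he : e ∈ increasingPairs n) :
    9 / 32 * r ^ 2 * (1 - p) ≤ (embeddedGraphLaw n p).real (stretchedPair r s e) := by
  have he' : e.1 ≠ e.2 := (Finset.mem_filter.1 he).2.ne
  have hn : (1 : ℝ) ≤ n := by
    have := e.1.pos
    exact_mod_cast this
  have hq : (0 : ℝ) ≤ 1 - p := by linarith [p.2.2]
  rw [embeddedGraphLaw, stretchedPair, measureReal_prod_prod, binomialRandom_real_not_adj p he']
  refine mul_le_mul_of_nonneg_right ?_ hq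
  have hπ := Real.pi_gt_three
  have hπ4 := Real.pi_le_four
  have hsπ : n * (s ^ 2 * Real.pi) ≤ 1 / 2 := by nlinarith [sq_nonneg s]
  have hsπ' : s ^ 2 * Real.pi ≤ 1 / 2 := by
    have : 0 ≤ s ^ 2 * Real.pi := by positivity
    nlinarith
  refine le_trans ?_ (le_pi_real_isolatedPair hr0 hr hs0 (by linarith) he')
  -- Bernoulli's inequality, with `n s² π ≤ 1/2`.
  have hpow : 1 / 2 ≤ (1 - s ^ 2 * Real.pi) ^ (n - 2) := by
    have h := one_add_mul_le_pow (a := -(s ^ 2 * Real.pi)) (by linarith) (n - 2)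
    have h' : ((n - 2 : ℕ) : ℝ) ≤ n := by exact_mod_cast Nat.sub_le n 2
    have : ((n - 2 : ℕ) : ℝ) * (s ^ 2 * Real.pi) ≤ n * (s ^ 2 * Real.pi) := by gcongr
    rw [← sub_eq_add_neg] at h
    linarith
  calc 9 / 32 * r ^ 2 = (1 / 4) ^ 2 * 3 * (r ^ 2 * 3 * (1 / 2)) := by ring
    _ ≤ _ := by gcongr

/-- Pairs that meet give an empty intersection; for four distinct indices, dropping isolation leaves
independent events, and `π ≤ 4` gives the factor `16`. -/
theorem embeddedGraphLaw_stretchedPair_inter_le {n : ℕ} (p : I) {r s : ℝ} (hr0 : 0 ≤ r)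
    (hrs : 2 * r ≤ s) {e f : Fin n × Fin n} (he : e ∈ increasingPairs n)
    (hf : f ∈ increasingPairs n) (hef : e ≠ f) :
    (embeddedGraphLaw n p).real (stretchedPair r s e ∩ stretchedPair r s f) ≤
      16 * (r ^ 2 * (1 - p)) ^ 2 := by
  obtain ⟨i, j⟩ := e
  obtain ⟨k, l⟩ := f
  have hij : i < j := (Finset.mem_filter.1 he).2
  have hkl : k < l := (Finset.mem_filter.1 hf).2
  rw [stretchedPair, stretchedPair, Set.prod_inter_prod]
  by_cases hmeet : i = k ∨ i = l ∨ j = k ∨ j = l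
  · rw [isolatedPair_inter_eq_empty hrs hij hkl hef hmeet, Set.empty_prod, measureReal_empty]
    positivity
  · push Not at hmeet
    obtain ⟨hik, hil, hjk, hjl⟩ := hmeet
    rw [embeddedGraphLaw, measureReal_prod_prod,
      binomialRandom_real_not_adj_inter p hij.ne hkl.ne (by simp [hik, hil])]
    have h1 := (measureReal_mono (μ := Measure.pi fun _ => uniformSquare)
      (Set.inter_subset_inter (isolatedPair_subset r s i j) (isolatedPair_subset r s k l))
      (measure_ne_top _ _)).trans (pi_real_closePair_inter_le hr0 hij.ne hkl.ne hik hil hjk hjl)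
    calc _ ≤ (r ^ 2 * 4) ^ 2 * (1 - p : ℝ) ^ 2 := by
          refine mul_le_mul_of_nonneg_right (h1.trans ?_) (sq_nonneg _)
          have := Real.pi_le_four
          gcongr
      _ = _ := by ring

theorem le_embeddedGraphLaw_biUnion_stretchedPair {n : ℕ} (hn : 2 ≤ n) (p : I) {r s : ℝ}
    (hr0 : 0 ≤ r) (hr : r ≤ 1 / 4) (hrs : 2 * r ≤ s) (hs : n * s ^ 2 ≤ 1 / 8)
    (ht : (n : ℝ) ^ 2 * (1 - p) * r ^ 2 ≤ 1 / 128) :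
    5 / 128 * ((n : ℝ) ^ 2 * (1 - p) * r ^ 2) ≤
      (embeddedGraphLaw n p).real (⋃ e ∈ increasingPairs n, stretchedPair r s e) := by
  have hs0 : 0 ≤ s := by linarith
  have hq : (0 : ℝ) ≤ 1 - p := by linarith [p.2.2]
  set u : ℝ := r ^ 2 * (1 - p) with hu
  have hu0 : 0 ≤ u := by positivity
  set N : ℝ := ((increasingPairs n).card : ℝ) with hN
  have hn2 : (2 : ℝ) ≤ n := by exact_mod_cast hn
  have hcard : 2 * N = (n : ℝ) * n - n := by
    have h := two_mul_card_increasingPairs n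
    have h' : n ≤ n * n := Nat.le_mul_self n
    rw [hN, ← Nat.cast_mul, ← Nat.cast_sub h', ← h]
    push_cast
    ring
  have hN1 : (n : ℝ) ^ 2 / 4 ≤ N := by nlinarith
  have hN2 : N ≤ (n : ℝ) ^ 2 / 2 := by nlinarith
  have hN0 : 0 ≤ N := by positivity
  refine le_trans ?_ (sum_sub_sum_inter_le_measureReal_biUnion _ _ (measurableSet_stretchedPair r s))
  have key : ∀ e ∈ increasingPairs n, 9 / 32 * u - N * (16 * u ^ 2) ≤
      (embeddedGraphLaw n p).real (stretchedPair r s e) - ∑ f ∈ (increasingPairs n).erase e,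
        (embeddedGraphLaw n p).real (stretchedPair r s e ∩ stretchedPair r s f) := by
    intro e he
    have h1 := le_embeddedGraphLaw_stretchedPair p hr0 hr hs0 hs he
    have h2 : ∑ f ∈ (increasingPairs n).erase e,
        (embeddedGraphLaw n p).real (stretchedPair r s e ∩ stretchedPair r s f) ≤
        N * (16 * u ^ 2) := by
      refine (Finset.sum_le_card_nsmul _ _ (16 * u ^ 2) fun f hf => ?_).trans ?_
      · exact embeddedGraphLaw_stretchedPair_inter_le p hr0 hrs he (Finset.mem_of_mem_erase hf)
          (Finset.ne_of_mem_erase hf).symm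
      · rw [nsmul_eq_mul]
        refine mul_le_mul_of_nonneg_right ?_ (by positivity)
        exact Nat.cast_le.2 (Finset.card_le_card (Finset.erase_subset _ _))
    rw [mul_assoc, ← hu] at h1
    linarith
  refine le_trans ?_ (Finset.card_nsmul_le_sum _ _ _ key)
  rw [nsmul_eq_mul, ← hN]
  set t : ℝ := (n : ℝ) ^ 2 * (1 - p) * r ^ 2 with ht'
  have htu : t = (n : ℝ) ^ 2 * u := by rw [ht', hu]; ring
  have ht0 : 0 ≤ t := by positivity
  have h1 : t / 4 ≤ N * u := by rw [htu]; nlinarith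
  have h2 : N * u ≤ t / 2 := by rw [htu]; nlinarith
  have h3 : (N * u) ^ 2 ≤ (t / 2) ^ 2 := pow_le_pow_left₀ (by positivity) h2 2
  have h4 : t ^ 2 ≤ t / 128 := by nlinarith
  -- The main term is at least `9t/128` and the correction at most `4t² ≤ 4t/128`.
  calc 5 / 128 * t ≤ 9 / 32 * (N * u) - 16 * (N * u) ^ 2 := by nlinarith
    _ = _ := by ring

theorem embeddedGraphLaw_real_not_connected {n : ℕ} (p : I) :
    (embeddedGraphLaw n p).real {ω | ¬ ω.2.Connected} =
      (SimpleGraph.binomialRandom (Fin n) p).real {G | ¬ G.Connected} := by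
  have : {ω : (Fin n → Plane) × SimpleGraph (Fin n) | ¬ ω.2.Connected} =
      Set.univ ×ˢ {G | ¬ G.Connected} := by
    ext; simp
  rw [this, embeddedGraphLaw, measureReal_prod_prod]
  simp

/-- If some stretched pair exists with probability at least `κ`, and its presence violates the
bound `b` on the stretch factor, then the bound fails on connected graphs with probability
at least `κ` minus the probability of being disconnected. -/
theorem embeddedGraphLaw_real_stretchFactor_le {n : ℕ} (p : I) {r s b κ : ℝ} (hr : 0 < r)
    (hs : 0 < s) (hb : b < s / r)
    (hκ : κ ≤ (embeddedGraphLaw n p).real (⋃ e ∈ increasingPairs n, stretchedPair r s e)) :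
    (embeddedGraphLaw n p).real
        {ω | ω.2.Connected → stretchFactor ω.1 ω.2 ≤ ENNReal.ofReal b} ≤
      1 - κ + (SimpleGraph.binomialRandom (Fin n) p).real {G | ¬ G.Connected} := by
  set U := ⋃ e ∈ increasingPairs n, stretchedPair (n := n) r s e
  have hU : MeasurableSet U :=
    Finset.measurableSet_biUnion _ fun e _ => measurableSet_stretchedPair r s e
  have hsub : {ω : (Fin n → Plane) × SimpleGraph (Fin n) |
      ω.2.Connected → stretchFactor ω.1 ω.2 ≤ ENNReal.ofReal b} ⊆
      Uᶜ ∪ {ω | ¬ ω.2.Connected} := by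
    intro ω hω
    by_cases hc : ω.2.Connected
    · refine Or.inl fun hωU => ?_
      simp only [U, Set.mem_iUnion] at hωU
      obtain ⟨e, he, hxe, hGe⟩ := hωU
      have h1 := le_stretchFactor_of_isolatedPair hr (Finset.mem_filter.1 he).2.ne hxe hGe
      have h2 := h1.trans (hω hc)
      -- As `b` may be negative, truncation by `ENNReal.ofReal` adds the alternative `s / r ≤ 0`,
      -- excluded by positivity.
      rw [ENNReal.ofReal_le_ofReal_iff'] at h2
      have : 0 < s / r := by positivity
      rcases h2 with h2 | h2 <;> linarith
    · exact Or.inr hc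
  refine (measureReal_mono hsub (measure_ne_top _ _)).trans ((measureReal_union_le _ _).trans ?_)
  rw [embeddedGraphLaw_real_not_connected, probReal_compl_eq_one_sub hU]
  linarith

end RandomEmbedding

/-! ### Choice of scales and conclusion. -/

theorem theorem3 (p : ℕ → unitInterval)
    (hp : ∃ ε : ℝ, 0 < ε ∧ ∀ᶠ n : ℕ in Filter.atTop, ε ≤ (p n : ℝ))
    (hq : ∃ δ : ℝ, 0 < δ ∧ ∀ᶠ n : ℕ in Filter.atTop, δ ≤ (n : ℝ) * (1 - (p n : ℝ))) :
    ¬ ∃ C : ℝ, RandomEmbedding.HoldsAas p fun n x G =>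
      G.Connected → RandomEmbedding.stretchFactor x G ≤
        ENNReal.ofReal (C * Real.sqrt ((n : ℝ) * (1 - (p n : ℝ))) / (p n : ℝ) + 1) := by
  rintro ⟨C, hC⟩
  have hconn := RandomEmbedding.tendsto_binomialRandom_not_connected p hp
  obtain ⟨ε, hε, hp⟩ := hp
  obtain ⟨δ, hδ, hq⟩ := hq
  have hδ' : 0 < √δ := Real.sqrt_pos.2 hδ
  -- Chosen so that the proposed bound is at most `K √(n(1-p))`: the second summand absorbs the `+
  -- 1`.
  set K : ℝ := |C| / ε + 1 / √δ with hK
  have hK0 : 0 < K := by positivity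
  -- The three constraints give, in turn, `2r ≤ s`, then `c² ≤ 1/128` for the Bonferroni estimate,
  -- and `K < 1 / (3c)` for the stretch to exceed the bound.
  obtain ⟨c, hc0, hc⟩ : ∃ c : ℝ, 0 < c ∧ (c ≤ √δ / 6 ∧ c ≤ 1 / 12 ∧ c ≤ 1 / (6 * K)) :=
    ⟨min (√δ / 6) (min (1 / 12) (1 / (6 * K))), by positivity,
      min_le_left _ _, (min_le_right _ _).trans (min_le_left _ _),
      (min_le_right _ _).trans (min_le_right _ _)⟩
  obtain ⟨hc1, hc2, hc3⟩ := hc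
  have hcK : K < 1 / (3 * c) := by
    rw [le_div_iff₀ (by positivity)] at hc3
    rw [lt_div_iff₀ (by positivity)]
    nlinarith
  set κ : ℝ := 5 / 128 * c ^ 2 with hκc
  have hκ : 0 < κ := by positivity
  have hbound : ∀ᶠ n : ℕ in Filter.atTop, (RandomEmbedding.embeddedGraphLaw n (p n)).real
      {ω | ω.2.Connected → RandomEmbedding.stretchFactor ω.1 ω.2 ≤
        ENNReal.ofReal (C * √((n : ℝ) * (1 - (p n : ℝ))) / (p n : ℝ) + 1)} ≤ 1 - κ / 2 := by
    filter_upwards [hp, hq, Filter.eventually_ge_atTop 2,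
      hconn.eventually_le_const (half_pos hκ)] with n hpn hqn hn hdisc
    have hp0 : 0 < (p n : ℝ) := hε.trans_le hpn
    have hn2 : (2 : ℝ) ≤ n := by exact_mod_cast hn
    have hnq : 0 < (n : ℝ) * (1 - p n) := hδ.trans_le hqn
    set y : ℝ := √((n : ℝ) * (1 - p n)) with hy
    have hy2 : y ^ 2 = n * (1 - p n) := Real.sq_sqrt hnq.le
    have hyδ : √δ ≤ y := Real.sqrt_le_sqrt hqn
    have hy0 : 0 < y := hδ'.trans_le hyδ
    set z : ℝ := √(n : ℝ) with hz
    have hz2 : z ^ 2 = n := Real.sq_sqrt (by positivity)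
    have hz0 : 0 < z := Real.sqrt_pos.2 (by positivity)
    have hz1 : 1 ≤ z := Real.one_le_sqrt.2 (by linarith)
    have hrs : 2 * (c / (z * y)) ≤ 1 / (3 * z) := by
      rw [← mul_div_assoc, div_le_div_iff₀ (by positivity) (by positivity)]
      nlinarith
    have hs1 : 1 / (3 * z) ≤ 1 / 3 := by
      rw [div_le_div_iff₀ (by positivity) (by positivity)]
      linarith
    have hs2 : (n : ℝ) * (1 / (3 * z)) ^ 2 = 1 / 9 := by
      rw [← hz2]; field_simp; norm_num
    have ht : (n : ℝ) ^ 2 * (1 - p n) * (c / (z * y)) ^ 2 = c ^ 2 := by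
      rw [div_pow, mul_pow, hy2, hz2]
      have : (1 - p n : ℝ) ≠ 0 := fun h => by simp [h] at hnq
      field_simp
    have hU := RandomEmbedding.le_embeddedGraphLaw_biUnion_stretchedPair hn (p n)
      (r := c / (z * y)) (s := 1 / (3 * z)) (by positivity) (by linarith) hrs (by linarith)
      (by rw [ht]; nlinarith)
    rw [ht] at hU
    have hb : C * y / p n + 1 < 1 / (3 * z) / (c / (z * y)) := by
      have e : 1 / (3 * z) / (c / (z * y)) = y * (1 / (3 * c)) := by field_simp
      rw [e]
      have h1 : C * y / p n ≤ |C| / ε * y := by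
        rw [mul_div_right_comm]
        refine mul_le_mul_of_nonneg_right ?_ hy0.le
        exact (div_le_div_of_nonneg_right (le_abs_self C) hp0.le).trans (by gcongr)
      have h2 : 1 ≤ 1 / √δ * y := by
        rw [one_div_mul_eq_div, le_div_iff₀ hδ']
        linarith
      have h3 : y * K < y * (1 / (3 * c)) := by gcongr
      rw [hK] at h3
      linarith
    have := RandomEmbedding.embeddedGraphLaw_real_stretchFactor_le (p n) (by positivity)
      (by positivity) hb hU
    exact this.trans (by rw [← hκc]; linarith)
  have hlim := (ENNReal.tendsto_toReal ENNReal.one_ne_top).comp hC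
  have := le_of_tendsto hlim hbound
  rw [ENNReal.toReal_one] at this
  linarith
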